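/- For $Z_1,\dots,Z_k,x\in\mathbb R^d$ and $r\ge 0$, the \emph{centrality SDP} with parameters $Z_1,\dots,Z_k,x,r$ is the problem of maximizing $\frac1k\sum_{i=1}^k b_i$ over all symmetric block matrices \[ Y=\begin{pmatrix}1&b^\top&u^\top\\ b&B&W\\ u&W^\top&U\end{pmatrix}\in\mathbb R^{(1+k+d)\times(1+k+d)},\qquad b\in\mathbb R^k,\ u\in\mathbb R^d,\ B\in\mathbb R^{k\times k},\ W\in\mathbb R^{k\times d},\ U\in\mathbb R^{d\times d}, \] subject to $Y\succeq 0$, $B_{ii}\le 1$ for $i=1,\dots,k$, $\operatorname{Tr}U\le 1$, and $\langle Z_i-x,W_i\rangle\ge r\,b_i$ for $i=1,\dots,k$, where $W_i$ is the $i$-th row of $W$. For $r>0$ and $p\in[0,1]$, the point $x$ is called \emph{certifiably $(r,p)$-central} with respect to $Z_1,\dots,Z_k$ if the optimum value of this SDP is at most $p$. There are absolute constants $C,c>0$ such that the following holds for every $d$ and every $k\ge 1$. Let $Z$ be a random vector in $\mathbb R^d$ with finite second moment, mean $\mu$ and covariance matrix $\Sigma$, and let $Z_1,\dots,Z_k$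 be i.i.d. copies of $Z$. Then for every $r>0$ with \[ r\ \ge\ C\left(\sqrt{\operatorname{Tr}\Sigma/k}+\sqrt{\|\Sigma\|}\right), \] where $\|\Sigma\|$ is the operator norm of $\Sigma$, with probability at least $1-2^{-ck}$ the mean $\mu$ is certifiably $(r,1/100)$-central with respect to $Z_1,\dots,Z_k$. -/

import Mathlib

open MeasureTheory ProbabilityTheory

noncomputable section

/-- Index set of the rows and columns of the `(d + k + 1) × (d + k + 1)` matrices of the
centrality SDP: one leading index, then `k` indices, then `d` indices. -/
abbrev SDPIndex (k d : ℕ) : Type := Unit ⊕ (Fin k ⊕ Fin d)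

namespace CentralitySDP

variable {k d : ℕ}

/-- The block `b ∈ ℝᵏ` of `Y = (1 bᵀ uᵀ; b B W; u Wᵀ U)`. -/
def blockb (Y : Matrix (SDPIndex k d) (SDPIndex k d) ℝ) (i : Fin k) : ℝ :=
  Y (.inr (.inl i)) (.inl ())

/-- The block `B ∈ ℝ^{k × k}` of `Y`. -/
def blockB (Y : Matrix (SDPIndex k d) (SDPIndex k d) ℝ) : Matrix (Fin k) (Fin k) ℝ :=
  Matrix.of fun i j => Y (.inr (.inl i)) (.inr (.inl j))

/-- The `i`-th row `W_i ∈ ℝᵈ` of the block `W ∈ ℝ^{k × d}` of `Y`. -/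
def rowW (Y : Matrix (SDPIndex k d) (SDPIndex k d) ℝ) (i : Fin k) : EuclideanSpace ℝ (Fin d) :=
  WithLp.toLp 2 fun j => Y (.inr (.inl i)) (.inr (.inr j))

/-- The block `U ∈ ℝ^{d × d}` of `Y`. -/
def blockU (Y : Matrix (SDPIndex k d) (SDPIndex k d) ℝ) : Matrix (Fin d) (Fin d) ℝ :=
  Matrix.of fun i j => Y (.inr (.inr i)) (.inr (.inr j))

/-- `Y` is a feasible solution of the centrality SDP with parameters `Z_1, …, Z_k, x, r`.
The symmetric block structure (`bᵀ`, `uᵀ`, `Wᵀ` above the diagonal or below it) is part of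
`Y.PosSemidef`. -/
structure Feasible (Z : Fin k → EuclideanSpace ℝ (Fin d)) (x : EuclideanSpace ℝ (Fin d)) (r : ℝ)
    (Y : Matrix (SDPIndex k d) (SDPIndex k d) ℝ) : Prop where
  corner : Y (.inl ()) (.inl ()) = 1
  diag_le : ∀ i, blockB Y i i ≤ 1
  trace_le : (blockU Y).trace ≤ 1
  inner_ge : ∀ i, r * blockb Y i ≤ inner ℝ (Z i - x) (rowW Y i)
  posSemidef : Y.PosSemidef

/-- The objective function `(1/k) ∑ b_i`. -/
def objective (Y : Matrix (SDPIndex k d) (SDPIndex k d) ℝ) : ℝ :=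
  (1 / (k : ℝ)) * ∑ i, blockb Y i

/-- The optimum value of the centrality SDP. The set of objective values is nonempty and bounded
above, see `objective_nonempty` and `objective_bddAbove`. -/
def value (Z : Fin k → EuclideanSpace ℝ (Fin d)) (x : EuclideanSpace ℝ (Fin d)) (r : ℝ) : ℝ :=
  sSup (objective '' {Y | Feasible Z x r Y})

lemma objective_nonempty (Z : Fin k → EuclideanSpace ℝ (Fin d)) (x : EuclideanSpace ℝ (Fin d))
    (r : ℝ) : (objective '' {Y | Feasible Z x r Y}).Nonempty := by
  refine ⟨_, Matrix.diagonal (fun a => Sum.elim (fun _ => (1 : ℝ)) (fun _ => 0) a), ?_, rfl⟩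
  refine ⟨by simp, by simp [blockB], by simp [blockU, Matrix.trace], ?_, ?_⟩
  · intro i
    have h : rowW (Matrix.diagonal (fun a : SDPIndex k d =>
        Sum.elim (fun _ => (1 : ℝ)) (fun _ => 0) a)) i = 0 := by
      ext j; simp [rowW]
    rw [h]; simp [blockb]
  · refine Matrix.PosSemidef.diagonal ?_
    rintro (a | a) <;> simp

lemma objective_bddAbove (Z : Fin k → EuclideanSpace ℝ (Fin d)) (x : EuclideanSpace ℝ (Fin d))
    (r : ℝ) : BddAbove (objective '' {Y | Feasible Z x r Y}) := by
  refine ⟨(1 / (k : ℝ)) * ∑ _i : Fin k, 1, ?_⟩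
  rintro _ ⟨Y, hY, rfl⟩
  refine mul_le_mul_of_nonneg_left (Finset.sum_le_sum fun i _ => ?_) (by positivity)
  have h := hY.posSemidef.dotProduct_mulVec_nonneg
    (Pi.single (.inl ()) (1 : ℝ) - Pi.single (.inr (.inl i)) 1)
  have hs : Y (.inl ()) (.inr (.inl i)) = Y (.inr (.inl i)) (.inl ()) := by
    simpa using hY.posSemidef.isHermitian.apply (.inr (.inl i)) (.inl ())
  have hd := hY.diag_le i
  have hc := hY.corner
  simp only [blockB, Matrix.of_apply] at hd
  simp [Matrix.mulVec_sub, sub_dotProduct, dotProduct_sub] at h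
  simp only [blockb]
  linarith

end CentralitySDP

/-- `x` is certifiably `(r, p)`-central with respect to `Z_1, …, Z_k`
(considered for `r > 0` and `p ∈ [0, 1]`). -/
def CertifiablyCentral {k d : ℕ} (Z : Fin k → EuclideanSpace ℝ (Fin d)) (r p : ℝ)
    (x : EuclideanSpace ℝ (Fin d)) : Prop :=
  CentralitySDP.value Z x r ≤ p

/-- The covariance matrix of a random vector in `ℝᵈ`. -/
def covMatrix {d : ℕ} {Ω : Type*} [MeasurableSpace Ω] (X : Ω → EuclideanSpace ℝ (Fin d))
    (P : Measure Ω) : Matrix (Fin d) (Fin d) ℝ :=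
  Matrix.of fun a b => cov[fun ω => X ω a, fun ω => X ω b; P]

/-- The `ℓ² → ℓ²` operator norm of a square matrix. -/
def matrixOpNorm {d : ℕ} (A : Matrix (Fin d) (Fin d) ℝ) : ℝ :=
  ‖Matrix.toEuclideanCLM (n := Fin d) (𝕜 := ℝ) A‖

end

open scoped NNReal RealInnerProductSpace

/-!
Write a feasible `Y` as a Gram matrix of vectors, and let `V` be the matrix whose columns are the
vectors attached to the block `U`. Then `b_i ≤ min 1 (‖V (Z_i - x)‖ / r)` and `‖V‖_HS ≤ 1`, so the
value of the SDP is at most the supremum over the Hilbert–Schmidt unit ball of the average of these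
numbers. Changing one sample moves that supremum by at most `1 / k`, so McDiarmid's inequality gives
the exponential tail, and only the expectation is left.

Rounding with a standard Gaussian vector bounds `∑ ‖V X_i‖` by `√(π / 2)` times
`sup_{‖u‖ ≤ 1} ∑ |⟪X_i, u⟫|`, where `X_i = Z_i - μ`. The mean of `|⟪X_i, u⟫|` is at most `√‖Σ‖`. The
deviation of the sum from its mean is symmetrized and contracted one sample at a time: each sample
becomes a random shift `± 2 X_i` of a linear tilt `⟪w, u⟫`, and the parallelogram law keeps the
expected norm of the accumulated tilt below `√(4 k Tr Σ)`.
-/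

section McDiarmid

variable {n : ℕ} {E : Fin n → Type*}

/-- Changing the `i`-th coordinate of its argument changes `f` by at most `c i`: the hypothesis of
McDiarmid's inequality. -/
def HasBoundedDifferences (f : (∀ i, E i) → ℝ) (c : Fin n → ℝ≥0) : Prop :=
  ∀ x i y, |f (Function.update x i y) - f x| ≤ c i

theorem HasBoundedDifferences.of_update_le {f : (∀ i, E i) → ℝ} {c : Fin n → ℝ≥0}
    (h : ∀ x i y, f (Function.update x i y) ≤ f x + c i) : HasBoundedDifferences f c := by
  refine fun x i y => abs_le.2 ⟨?_, by linarith [h x i y]⟩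
  have hback := h (Function.update x i y) i (x i)
  rw [Function.update_idem, Function.update_eq_self] at hback
  linarith

theorem HasBoundedDifferences.iSup {ι : Type*} [Nonempty ι] {φ : ι → (∀ i, E i) → ℝ}
    {c : Fin n → ℝ≥0} (hφ : ∀ a, HasBoundedDifferences (φ a) c)
    (hbdd : ∀ x, BddAbove (Set.range fun a => φ a x)) :
    HasBoundedDifferences (fun x => ⨆ a, φ a x) c :=
  .of_update_le fun x i y => ciSup_le fun a =>
    (sub_le_iff_le_add'.1 (abs_le.1 (hφ a x i y)).2).trans
      (add_le_add_left (le_ciSup (hbdd x) a) _)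

theorem HasBoundedDifferences.const_mul {f : (∀ i, E i) → ℝ} {c : Fin n → ℝ≥0}
    (hf : HasBoundedDifferences f c) (a : ℝ≥0) :
    HasBoundedDifferences (fun x => a * f x) (fun i => a * c i) := fun x i y => by
  rw [← mul_sub, abs_mul, abs_of_nonneg a.coe_nonneg, NNReal.coe_mul]
  exact mul_le_mul_of_nonneg_left (hf x i y) a.coe_nonneg

theorem hasBoundedDifferences_sum {F : Type*} {n : ℕ} {φ : F → ℝ} {c : ℝ≥0}
    (hφ : ∀ x y, φ x - φ y ≤ c) :
    HasBoundedDifferences (fun x : Fin n → F => ∑ i, φ (x i)) fun _ => c := by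
  refine .of_update_le fun x i y => sub_le_iff_le_add'.1 ?_
  rw [← Finset.sum_sub_distrib, Finset.sum_eq_single i (fun j _ hj => by simp [hj]) (by simp)]
  simpa using hφ y (x i)

theorem hasSubgaussianMGF_sub_integral_of_abs_sub_le {α : Type*} [MeasurableSpace α]
    {ν : Measure α} [IsProbabilityMeasure ν] {g : α → ℝ} (hg : Measurable g) {c : ℝ≥0}
    (hgc : ∀ x y, |g x - g y| ≤ c) :
    HasSubgaussianMGF (fun x => g x - ∫ y, g y ∂ν) (c ^ 2 / 4) ν := by
  have := nonempty_of_isProbabilityMeasure ν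
  have hle : ∀ x y, g y ≤ g x + c := fun x y => by linarith [(abs_le.1 (hgc x y)).1]
  have hbdd (x : α) : BddAbove (Set.range g) := ⟨g x + c, Set.forall_mem_range.2 (hle x)⟩
  convert hasSubgaussianMGF_of_mem_Icc (a := (⨆ y, g y) - c) (b := ⨆ y, g y) hg.aemeasurable
    (.of_forall fun x => ⟨by linarith [ciSup_le (hle x)], le_ciSup (hbdd x) x⟩) using 1
  · rw [sub_sub_cancel, NNReal.nnnorm_eq, div_pow]
    norm_num
  · infer_instance

theorem hasSubgaussianMGF_add_prod {α β : Type*} [MeasurableSpace α] [MeasurableSpace β]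
    {μ : Measure α} {κ : Measure β} [SFinite μ] [SFinite κ] {X : α → ℝ} {Y : α × β → ℝ}
    {a b : ℝ≥0} (hX : HasSubgaussianMGF X a μ) (hY : Measurable Y)
    (hYsub : ∀ x, HasSubgaussianMGF (fun y => Y (x, y)) b κ) :
    HasSubgaussianMGF (fun p => X p.1 + Y p) (a + b) (μ.prod κ) := by
  have hsplit (t : ℝ) (x : α) (y : β) :
      Real.exp (t * (X x + Y (x, y))) = Real.exp (t * X x) * Real.exp (t * Y (x, y)) := by
    rw [mul_add, Real.exp_add]
  have hfibre (t : ℝ) (x : α) : ∫ y, Real.exp (t * (X x + Y (x, y))) ∂κ ≤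
      Real.exp (t * X x) * Real.exp (b * t ^ 2 / 2) := by
    simp_rw [hsplit, integral_const_mul]
    exact mul_le_mul_of_nonneg_left ((hYsub x).mgf_le t) (Real.exp_nonneg _)
  have hdom (t : ℝ) : Integrable (fun x => Real.exp (t * X x) * Real.exp (b * t ^ 2 / 2)) μ :=
    (hX.integrable_exp_mul t).mul_const _
  have hint (t : ℝ) : Integrable (fun p => Real.exp (t * (X p.1 + Y p))) (μ.prod κ) := by
    have hmeas : AEStronglyMeasurable (fun p => Real.exp (t * (X p.1 + Y p))) (μ.prod κ) :=
      Real.continuous_exp.comp_aestronglyMeasurable <|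
        (hX.aestronglyMeasurable.comp_fst.add hY.aestronglyMeasurable).const_mul t
    refine (integrable_prod_iff hmeas).2 ⟨.of_forall fun x => ?_, ?_⟩
    · simp_rw [hsplit]
      exact ((hYsub x).integrable_exp_mul t).const_mul _
    · refine (hdom t).mono' hmeas.norm.integral_prod_right' (.of_forall fun x => ?_)
      simp_rw [Real.norm_eq_abs, Real.abs_exp]
      rw [abs_of_nonneg (integral_nonneg fun y => Real.exp_nonneg _)]
      exact hfibre t x
  refine ⟨hint, fun t => ?_⟩
  calc mgf (fun p => X p.1 + Y p) (μ.prod κ) t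
      = ∫ x, ∫ y, Real.exp (t * (X x + Y (x, y))) ∂κ ∂μ := integral_prod _ (hint t)
    _ ≤ ∫ x, Real.exp (t * X x) * Real.exp (b * t ^ 2 / 2) ∂μ :=
        integral_mono (hint t).integral_prod_left (hdom t) (hfibre t)
    _ ≤ Real.exp (a * t ^ 2 / 2) * Real.exp (b * t ^ 2 / 2) := by
        rw [integral_mul_const]
        exact mul_le_mul_of_nonneg_right (hX.mgf_le t) (Real.exp_nonneg _)
    _ = Real.exp ((a + b : ℝ≥0) * t ^ 2 / 2) := by
        rw [← Real.exp_add, NNReal.coe_add]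
        ring_nf

theorem measurePreserving_head_tail {n : ℕ} {E : Fin (n + 1) → Type*}
    [∀ i, MeasurableSpace (E i)] (ν : ∀ i, Measure (E i)) [∀ i, SigmaFinite (ν i)] :
    MeasurePreserving (fun x : ∀ i, E i => (x 0, Fin.tail x)) (Measure.pi ν)
      ((ν 0).prod (Measure.pi fun i : Fin n => ν i.succ)) :=
  measurePreserving_piFinSuccAbove ν 0

theorem integral_pi_eq_integral_prod_cons {n : ℕ} {E : Fin (n + 1) → Type*}
    [∀ i, MeasurableSpace (E i)] (ν : ∀ i, Measure (E i)) [∀ i, SigmaFinite (ν i)]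
    {G : Type*} [NormedAddCommGroup G] [NormedSpace ℝ G] {f : (∀ i, E i) → G}
    (hf : AEStronglyMeasurable (fun p : E 0 × (∀ i : Fin n, E i.succ) => f (Fin.cons p.1 p.2))
      ((ν 0).prod (Measure.pi fun i : Fin n => ν i.succ))) :
    ∫ x, f x ∂Measure.pi ν =
      ∫ p, f (Fin.cons p.1 p.2) ∂(ν 0).prod (Measure.pi fun i : Fin n => ν i.succ) := by
  have hsplit := measurePreserving_head_tail ν
  rw [← hsplit.map_eq] at hf ⊢
  rw [integral_map hsplit.aemeasurable hf]
  simp only [Fin.cons_self_tail]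

theorem HasBoundedDifferences.hasSubgaussianMGF :
    ∀ {n : ℕ} {E : Fin n → Type*} [∀ i, MeasurableSpace (E i)] (ν : ∀ i, Measure (E i))
      [∀ i, IsProbabilityMeasure (ν i)] {f : (∀ i, E i) → ℝ} {c : Fin n → ℝ≥0},
      Measurable f → HasBoundedDifferences f c →
      HasSubgaussianMGF (fun x => f x - ∫ y, f y ∂Measure.pi ν) ((∑ i, c i ^ 2) / 4)
        (Measure.pi ν)
  | 0, _, _, ν, _, f, _, _, _ => by
    have hconst : f = fun _ => f isEmptyElim := funext fun x => congrArg f (Subsingleton.elim x _)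
    rw [hconst]
    simp
  | n + 1, E, _, ν, _, f, c, hf, hc => by
    let κ : Measure (∀ i : Fin n, E i.succ) := Measure.pi fun i => ν i.succ
    let g (p : E 0 × (∀ i : Fin n, E i.succ)) : ℝ := f (Fin.cons p.1 p.2)
    have hg : Measurable g :=
      hf.comp <| measurable_pi_lambda _ <|
        Fin.cases measurable_fst fun i => (measurable_pi_apply i).comp measurable_snd
    let F (x : E 0) : ℝ := ∫ y, g (x, y) ∂κ
    have htail (x : E 0) :
        HasSubgaussianMGF (fun y => g (x, y) - F x) ((∑ i : Fin n, c i.succ ^ 2) / 4) κ :=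
      HasBoundedDifferences.hasSubgaussianMGF (fun i => ν i.succ)
        (hg.comp measurable_prodMk_left) fun y i z => by
          simpa only [g, Fin.cons_update] using hc (Fin.cons x y) i.succ z
    have hgint (x : E 0) : Integrable (fun y => g (x, y)) κ := by
      simpa only [sub_eq_add_neg, integrable_add_const_iff] using (htail x).integrable
    have hF : Measurable F := hg.stronglyMeasurable.integral_prod_right'.measurable
    have hhead : HasSubgaussianMGF (fun x => F x - ∫ x, F x ∂ν 0) (c 0 ^ 2 / 4) (ν 0) := by
      refine hasSubgaussianMGF_sub_integral_of_abs_sub_le hF fun x x' => ?_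
      rw [← integral_sub (hgint x) (hgint x'), ← Real.norm_eq_abs]
      refine (norm_integral_le_of_norm_le_const (μ := κ) (.of_forall fun y => ?_)).trans_eq
        (by rw [probReal_univ, mul_one])
      simpa only [g, Fin.update_cons_zero, Real.norm_eq_abs] using hc (Fin.cons x' y) 0 x
    have hprod : HasSubgaussianMGF (fun p => g p - ∫ x, F x ∂ν 0) ((∑ i, c i ^ 2) / 4)
        ((ν 0).prod κ) := by
      convert hasSubgaussianMGF_add_prod hhead (hg.sub (hF.comp measurable_fst)) htail using 1
      · ext p
        simp
      · rw [Fin.sum_univ_succ, add_div]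
    have hmean : ∫ x, f x ∂Measure.pi ν = ∫ x, F x ∂ν 0 :=
      (integral_pi_eq_integral_prod_cons ν hg.aestronglyMeasurable).trans <| integral_prod _ <| by
        simpa only [sub_eq_add_neg, integrable_add_const_iff] using hprod.integrable
    have hsplit := measurePreserving_head_tail ν
    rw [← hmean, ← hsplit.map_eq] at hprod
    simpa only [g, Function.comp_def, Fin.cons_self_tail] using
      hprod.of_map hsplit.aemeasurable

theorem HasBoundedDifferences.measureReal_integral_add_le [∀ i, MeasurableSpace (E i)]
    {ν : ∀ i, Measure (E i)} [∀ i, IsProbabilityMeasure (ν i)] {f : (∀ i, E i) → ℝ}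
    {c : Fin n → ℝ≥0} (hc : HasBoundedDifferences f c) (hf : Measurable f) {ε : ℝ} (hε : 0 ≤ ε) :
    (Measure.pi ν).real {x | ∫ y, f y ∂Measure.pi ν + ε ≤ f x} ≤
      Real.exp (-2 * ε ^ 2 / ∑ i, (c i : ℝ) ^ 2) := by
  convert (HasBoundedDifferences.hasSubgaussianMGF ν hf hc).measure_ge_le hε using 2
  · simp only [le_sub_iff_add_le']
  · push_cast
    ring

end McDiarmid

section TiltedDeviation

theorem integrable_sqrt {α : Type*} [MeasurableSpace α] {ν : Measure α} [IsFiniteMeasure ν]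
    {f : α → ℝ} (hf : Integrable f ν) : Integrable (fun x => √(f x)) ν := by
  refine (hf.norm.add (integrable_const 1)).mono'
    (Real.continuous_sqrt.comp_aestronglyMeasurable hf.1) (.of_forall fun x => ?_)
  rw [Real.norm_of_nonneg (Real.sqrt_nonneg _), Real.sqrt_le_iff]
  have := le_abs_self (f x)
  simp only [Pi.add_apply, Real.norm_eq_abs]
  constructor <;> nlinarith [abs_nonneg (f x)]

theorem integral_sqrt_le_sqrt_integral {α : Type*} [MeasurableSpace α] {ν : Measure α}
    [IsProbabilityMeasure ν] {f : α → ℝ} (hf₀ : ∀ x, 0 ≤ f x) (hf : Integrable f ν) :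
    ∫ x, √(f x) ∂ν ≤ √(∫ x, f x ∂ν) :=
  Real.strictConcaveOn_sqrt.concaveOn.le_map_integral Real.continuous_sqrt.continuousOn
    isClosed_Ici (.of_forall hf₀) hf (integrable_sqrt hf)

theorem bddAbove_range_of_abs_le {ι : Type*} {ψ : ι → ℝ} {b : ℝ} (hψ : ∀ u, |ψ u| ≤ b) :
    BddAbove (Set.range ψ) :=
  ⟨b, Set.forall_mem_range.2 fun u => (le_abs_self _).trans (hψ u)⟩

theorem integrable_iSup {ι α : Type*} [Nonempty ι] [TopologicalSpace α] [MeasurableSpace α]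
    [OpensMeasurableSpace α] {ν : Measure α} {ψ : ι → α → ℝ}
    (hψ : ∀ u, LowerSemicontinuous (ψ u)) {b : α → ℝ} (hb : Integrable b ν)
    (hψb : ∀ u x, |ψ u x| ≤ b x) : Integrable (fun x => ⨆ u, ψ u x) ν := by
  have hbdd (x) := bddAbove_range_of_abs_le (hψb · x)
  refine hb.mono' (lowerSemicontinuous_ciSup hbdd hψ).measurable.aestronglyMeasurable
    (.of_forall fun x => abs_le.2 ⟨?_, ciSup_le fun u => (le_abs_self _).trans (hψb u x)⟩)
  obtain ⟨u⟩ := ‹Nonempty ι›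
  exact (abs_le.1 (hψb u x)).1.trans (le_ciSup (hbdd x) u)

theorem integrable_iSup_add_mul {ι α : Type*} [Nonempty ι] [TopologicalSpace α]
    [MeasurableSpace α] [OpensMeasurableSpace α] {ν : Measure α} [IsFiniteMeasure ν]
    {g : ι → ℝ} {K : ℝ} (hg : ∀ u, |g u| ≤ K) {φ : ι → α → ℝ} (hφ : ∀ u, Continuous (φ u))
    {b : α → ℝ} (hb : Integrable b ν) (hφb : ∀ u x, |φ u x| ≤ b x) (s : ℝ) :
    Integrable (fun x => ⨆ u, (g u + s * φ u x)) ν := by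
  refine integrable_iSup (b := fun x => K + |s| * b x)
    (fun u => (by fun_prop : Continuous _).lowerSemicontinuous)
    (.add (integrable_const K) (hb.const_mul _)) fun u x => ?_
  grw [abs_add_le, abs_mul, hg, hφb]

/-- The contraction principle for `|·|` at a single Rademacher sign. -/
theorem iSup_add_abs_add_iSup_sub_abs_le {ι : Type*} [Nonempty ι] {g a : ι → ℝ}
    (hadd : BddAbove (Set.range fun u => g u + a u))
    (hsub : BddAbove (Set.range fun u => g u - a u)) :
    (⨆ u, (g u + |a u|)) + ⨆ u, (g u - |a u|) ≤ (⨆ u, (g u + a u)) + ⨆ u, (g u - a u) := by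
  refine ciSup_add_ciSup_le fun u v => ?_
  have hu := le_ciSup hadd u
  have hv := le_ciSup hadd v
  have hu' := le_ciSup hsub u
  have hv' := le_ciSup hsub v
  rcases abs_cases (a u) with ⟨hau, -⟩ | ⟨hau, -⟩ <;>
    linarith [le_abs_self (a v), neg_le_abs (a v)]

/-- Symmetrization of a single sample: splitting `g` evenly between the sample and an independent
copy produces both signs without introducing a Rademacher variable. -/
theorem integral_iSup_add_sub_integral_le {ι α : Type*} [Nonempty ι] [TopologicalSpace α]
    [MeasurableSpace α] [OpensMeasurableSpace α] {ν : Measure α} [IsProbabilityMeasure ν]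
    {g : ι → ℝ} {K : ℝ} (hg : ∀ u, |g u| ≤ K) {φ : ι → α → ℝ} (hφ : ∀ u, Continuous (φ u))
    {b : α → ℝ} (hb : Integrable b ν) (hφb : ∀ u x, |φ u x| ≤ b x) :
    ∫ x, ⨆ u, (g u + (φ u x - ∫ y, φ u y ∂ν)) ∂ν ≤
      ∫ x, ((⨆ u, (g u + 2 * φ u x)) + ⨆ u, (g u + -2 * φ u x)) / 2 ∂ν := by
  have hφint (u) : Integrable (φ u) ν :=
    hb.mono' (hφ u).measurable.aestronglyMeasurable (.of_forall (hφb u))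
  have hcentred (u) : |∫ y, φ u y ∂ν| ≤ ∫ y, b y ∂ν :=
    norm_integral_le_of_norm_le (f := φ u) hb (.of_forall (hφb u))
  have hint : Integrable (fun x => ⨆ u, (g u + (φ u x - ∫ y, φ u y ∂ν))) ν :=
    integrable_iSup (b := fun x => K + (b x + ∫ y, b y ∂ν))
      (fun u => (by fun_prop : Continuous _).lowerSemicontinuous)
      (.add (integrable_const K) (hb.add (integrable_const _))) fun u x => by
        grw [abs_add_le, abs_sub, hg, hφb, hcentred]
  have hsup (s : ℝ) := integrable_iSup_add_mul hg hφ hb hφb s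
  have hle (s : ℝ) (u) (x) : g u + s * φ u x ≤ ⨆ u, (g u + s * φ u x) := by
    refine le_ciSup (f := fun u => g u + s * φ u x)
      (bddAbove_range_of_abs_le (b := K + |s| * b x) fun u => ?_) u
    grw [abs_add_le, abs_mul, hg, hφb]
  have hmean (u) : g u + -2 * ∫ y, φ u y ∂ν ≤ ∫ y, ⨆ u, (g u + -2 * φ u y) ∂ν := by
    simpa only [integral_add' (integrable_const (g u)) ((hφint u).const_mul (-2)),
      integral_const_mul, integral_const, probReal_univ, one_smul] using
      integral_mono ((integrable_const (g u)).add ((hφint u).const_mul (-2))) (hsup (-2))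
        (hle (-2) u)
  have hpointwise (x) : ⨆ u, (g u + (φ u x - ∫ y, φ u y ∂ν)) ≤
      ((⨆ u, (g u + 2 * φ u x)) + ∫ y, ⨆ u, (g u + -2 * φ u y) ∂ν) / 2 :=
    ciSup_le fun u => by linarith [hmean u, hle 2 u x]
  refine (integral_mono hint (((hsup 2).add (integrable_const _)).div_const 2)
    hpointwise).trans_eq ?_
  rw [integral_div, integral_div, integral_add' (hsup 2) (integrable_const _),
    integral_add (hsup 2) (hsup (-2)), integral_const, probReal_univ, one_smul]

theorem integral_iSup_add_abs_sub_integral_le {ι α : Type*} [Nonempty ι] [TopologicalSpace α]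
    [MeasurableSpace α] [OpensMeasurableSpace α] {ν : Measure α} [IsProbabilityMeasure ν]
    {g : ι → ℝ} {K : ℝ} (hg : ∀ u, |g u| ≤ K) {φ : ι → α → ℝ} (hφ : ∀ u, Continuous (φ u))
    {b : α → ℝ} (hb : Integrable b ν) (hφb : ∀ u x, |φ u x| ≤ b x) :
    ∫ x, ⨆ u, (g u + (|φ u x| - ∫ y, |φ u y| ∂ν)) ∂ν ≤
      ∫ x, ((⨆ u, (g u + 2 * φ u x)) + ⨆ u, (g u + -2 * φ u x)) / 2 ∂ν := by
  have habs (u) (x) : |(|φ u x|)| ≤ b x := (abs_abs _).trans_le (hφb u x)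
  have hsup (s : ℝ) := integrable_iSup_add_mul hg hφ hb hφb s
  have hsup_abs (s : ℝ) := integrable_iSup_add_mul hg (fun u => (hφ u).abs) hb habs s
  have hbdd (s : ℝ) (x) : BddAbove (Set.range fun u => g u + s * φ u x) :=
    bddAbove_range_of_abs_le (b := K + |s| * b x) fun u => by
      grw [abs_add_le, abs_mul, hg, hφb]
  refine (integral_iSup_add_sub_integral_le hg (fun u => (hφ u).abs) hb habs).trans
    (integral_mono (((hsup_abs 2).add (hsup_abs (-2))).div_const 2)
      (((hsup 2).add (hsup (-2))).div_const 2) fun x => div_le_div_of_nonneg_right ?_ zero_le_two)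
  simpa only [Pi.add_apply, abs_mul, abs_two, neg_mul, ← sub_eq_add_neg] using
    iSup_add_abs_add_iSup_sub_abs_le (a := fun u => 2 * φ u x) (hbdd 2 x)
      (by simpa only [neg_mul, ← sub_eq_add_neg] using hbdd (-2) x)

variable {E : Type*} [NormedAddCommGroup E] [InnerProductSpace ℝ E]

instance nonempty_unitBall : Nonempty (Metric.closedBall (0 : E) 1) :=
  ⟨⟨0, Metric.mem_closedBall_self zero_le_one⟩⟩

theorem abs_inner_le_of_mem_unitBall (x : E) (u : Metric.closedBall (0 : E) 1) :
    |⟪x, (u : E)⟫| ≤ ‖x‖ :=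
  (abs_real_inner_le_norm _ _).trans <|
    mul_le_of_le_one_right (norm_nonneg _) (mem_closedBall_zero_iff.1 u.2)

theorem add_sqrt_norm_sq_add_div_two_le (w x : E) {a : ℝ} (ha : 0 ≤ a) :
    (√(‖w + x‖ ^ 2 + a) + √(‖w - x‖ ^ 2 + a)) / 2 ≤ √(‖w‖ ^ 2 + ‖x‖ ^ 2 + a) := by
  have hp := parallelogram_law_with_norm ℝ w x
  refine Real.le_sqrt_of_sq_le ?_
  have hadd := Real.sq_sqrt (add_nonneg (sq_nonneg ‖w + x‖) ha)
  have hsub := Real.sq_sqrt (add_nonneg (sq_nonneg ‖w - x‖) ha)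
  nlinarith [sq_nonneg (√(‖w + x‖ ^ 2 + a) - √(‖w - x‖ ^ 2 + a))]

variable [MeasurableSpace E]

/-- The supremum over the unit ball of `∑ (|⟪X i, u⟫| - 𝔼 |⟪y, u⟫|)`, tilted by the linear
functional `⟪w, u⟫`. Symmetrizing one sample at a time turns that sample into a random change of the
tilt `w`. -/
noncomputable def tiltedDeviation (ν : Measure E) {n : ℕ} (w : E) (X : Fin n → E) : ℝ :=
  ⨆ u : Metric.closedBall (0 : E) 1,
    (⟪w, u⟫ + ∑ i, (|⟪X i, u⟫| - ∫ y, |⟪y, (u : E)⟫| ∂ν))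

variable {ν : Measure E} {n : ℕ}

theorem tiltedDeviation_cons (w x : E) (X : Fin n → E) :
    tiltedDeviation ν w (Fin.cons x X : Fin (n + 1) → E) =
      ⨆ u : Metric.closedBall (0 : E) 1, (⟪w, u⟫ + ∑ i, (|⟪X i, u⟫| - ∫ y, |⟪y, (u : E)⟫| ∂ν) +
        (|⟪x, u⟫| - ∫ y, |⟪y, (u : E)⟫| ∂ν)) := by
  simp only [tiltedDeviation, Fin.sum_univ_succ, Fin.cons_zero, Fin.cons_succ]
  exact iSup_congr fun u => by ring

theorem tiltedDeviation_add_left (w x : E) (X : Fin n → E) :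
    tiltedDeviation ν (w + x) X =
      ⨆ u : Metric.closedBall (0 : E) 1,
        (⟪w, u⟫ + ∑ i, (|⟪X i, u⟫| - ∫ y, |⟪y, (u : E)⟫| ∂ν) + ⟪x, u⟫) := by
  simp only [tiltedDeviation, inner_add_left]
  exact iSup_congr fun u => by ring

theorem abs_tilted_sum_le (hν : Integrable id ν) (w : E) (X : Fin n → E)
    (u : Metric.closedBall (0 : E) 1) :
    |⟪w, (u : E)⟫ + ∑ i, (|⟪X i, (u : E)⟫| - ∫ y, |⟪y, (u : E)⟫| ∂ν)| ≤
      ‖w‖ + ∑ i, (‖X i‖ + ∫ y, ‖y‖ ∂ν) := by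
  have hmean : |∫ y, |⟪y, (u : E)⟫| ∂ν| ≤ ∫ y, ‖y‖ ∂ν :=
    norm_integral_le_of_norm_le (f := fun y => |⟪y, (u : E)⟫|) hν.norm <| .of_forall fun y => by
      simpa using abs_inner_le_of_mem_unitBall y u
  refine (abs_add_le _ _).trans (add_le_add (abs_inner_le_of_mem_unitBall w u) ?_)
  refine (Finset.abs_sum_le_sum_abs _ _).trans (Finset.sum_le_sum fun i _ => ?_)
  grw [abs_sub, hmean, abs_abs, abs_inner_le_of_mem_unitBall]

theorem le_tiltedDeviation (hν : Integrable id ν) (w : E) (X : Fin n → E)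
    (u : Metric.closedBall (0 : E) 1) :
    ⟪w, u⟫ + ∑ i, (|⟪X i, u⟫| - ∫ y, |⟪y, (u : E)⟫| ∂ν) ≤ tiltedDeviation ν w X :=
  le_ciSup (bddAbove_range_of_abs_le (abs_tilted_sum_le hν w X)) u

theorem tiltedDeviation_nonneg (hν : Integrable id ν) (w : E) (X : Fin n → E) :
    0 ≤ tiltedDeviation ν w X := by
  simpa using le_tiltedDeviation hν w X ⟨0, Metric.mem_closedBall_self zero_le_one⟩

theorem integrable_tiltedDeviation {α : Type*} [TopologicalSpace α] [MeasurableSpace α]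
    [OpensMeasurableSpace α] {P : Measure α} [IsFiniteMeasure P] (hν : Integrable id ν)
    {w : α → E} {X : Fin n → α → E} (hw : Continuous w) (hX : ∀ i, Continuous (X i))
    (hwint : Integrable w P) (hXint : ∀ i, Integrable (X i) P) :
    Integrable (fun a => tiltedDeviation ν (w a) fun i => X i a) P :=
  integrable_iSup (fun u => (by fun_prop : Continuous _).lowerSemicontinuous)
    (hwint.norm.add (integrable_finsetSum _ fun i _ => (hXint i).norm.add (integrable_const _)))
    fun u a => abs_tilted_sum_le hν (w a) (fun i => X i a) u

theorem integral_tiltedDeviation_cons_le [BorelSpace E] [IsProbabilityMeasure ν]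
    (hν : Integrable id ν) (w : E) (X : Fin n → E) :
    ∫ x, tiltedDeviation ν w (Fin.cons x X : Fin (n + 1) → E) ∂ν ≤
      ∫ x, (tiltedDeviation ν (w + (2 : ℝ) • x) X + tiltedDeviation ν (w + (-2 : ℝ) • x) X) / 2
        ∂ν := by
  simp_rw [tiltedDeviation_cons, tiltedDeviation_add_left, real_inner_smul_left]
  exact integral_iSup_add_abs_sub_integral_le (abs_tilted_sum_le hν w X) (fun u => by fun_prop)
    hν.norm fun u x => abs_inner_le_of_mem_unitBall x u

theorem integral_tiltedDeviation_succ_le [BorelSpace E] [SecondCountableTopology E]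
    [IsProbabilityMeasure ν] (hν : Integrable id ν) (w : E) :
    ∫ X : Fin (n + 1) → E, tiltedDeviation ν w X ∂Measure.pi (fun _ => ν) ≤
      ∫ x, (∫ X : Fin n → E, tiltedDeviation ν (w + (2 : ℝ) • x) X ∂Measure.pi (fun _ => ν) +
        ∫ X : Fin n → E, tiltedDeviation ν (w + (-2 : ℝ) • x) X ∂Measure.pi (fun _ => ν)) / 2
        ∂ν := by
  let κ : Measure (Fin n → E) := Measure.pi fun _ => ν
  have hsample (i : Fin n) : Integrable (fun p : E × (Fin n → E) => p.2 i) (ν.prod κ) :=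
    (integrable_comp_eval (μ := fun _ => ν) (f := id) hν).comp_snd ν
  have hcont : ∀ i, Continuous fun p : E × (Fin n → E) =>
      (Fin.cons p.1 p.2 : Fin (n + 1) → E) i := by
    simp only [Fin.forall_fin_succ, Fin.cons_zero, Fin.cons_succ]
    exact ⟨by fun_prop, fun i => by fun_prop⟩
  have hint : ∀ i, Integrable (fun p : E × (Fin n → E) =>
      (Fin.cons p.1 p.2 : Fin (n + 1) → E) i) (ν.prod κ) := by
    simp only [Fin.forall_fin_succ, Fin.cons_zero, Fin.cons_succ]
    exact ⟨hν.comp_fst κ, hsample⟩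
  have hcons : Integrable (fun p : E × (Fin n → E) =>
      tiltedDeviation ν w (Fin.cons p.1 p.2 : Fin (n + 1) → E)) (ν.prod κ) :=
    integrable_tiltedDeviation hν continuous_const hcont (integrable_const w) hint
  have htilt (s : ℝ) : Integrable (fun p : E × (Fin n → E) =>
      tiltedDeviation ν (w + s • p.1) p.2) (ν.prod κ) :=
    integrable_tiltedDeviation hν (by fun_prop) (fun i => by fun_prop)
      ((integrable_const w).add ((hν.comp_fst κ).smul s)) hsample
  have havg := ((htilt 2).add (htilt (-2))).div_const 2
  calc ∫ X : Fin (n + 1) → E, tiltedDeviation ν w X ∂Measure.pi (fun _ => ν)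
      = ∫ p, tiltedDeviation ν w (Fin.cons p.1 p.2 : Fin (n + 1) → E) ∂ν.prod κ :=
        integral_pi_eq_integral_prod_cons (fun _ => ν) hcons.aestronglyMeasurable
    _ = ∫ X, ∫ x, tiltedDeviation ν w (Fin.cons x X : Fin (n + 1) → E) ∂ν ∂κ :=
        integral_prod_symm _ hcons
    _ ≤ ∫ X, ∫ x, (tiltedDeviation ν (w + (2 : ℝ) • x) X +
          tiltedDeviation ν (w + (-2 : ℝ) • x) X) / 2 ∂ν ∂κ :=
        integral_mono hcons.integral_prod_right havg.integral_prod_right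
          (integral_tiltedDeviation_cons_le hν w)
    _ = ∫ x, ∫ X, (tiltedDeviation ν (w + (2 : ℝ) • x) X +
          tiltedDeviation ν (w + (-2 : ℝ) • x) X) / 2 ∂κ ∂ν :=
        integral_integral_swap havg.swap
    _ = _ := by
        refine integral_congr_ae ?_
        filter_upwards [(htilt 2).prod_right_ae, (htilt (-2)).prod_right_ae] with x h₁ h₂
        rw [integral_div, integral_add h₁ h₂]

theorem integral_tiltedDeviation_le [BorelSpace E] [SecondCountableTopology E]
    [IsProbabilityMeasure ν] (hν : MemLp id 2 ν) :
    ∀ (n : ℕ) (w : E), ∫ X : Fin n → E, tiltedDeviation ν w X ∂Measure.pi (fun _ => ν) ≤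
      √(‖w‖ ^ 2 + 4 * n * ∫ x, ‖x‖ ^ 2 ∂ν)
  | 0, w => by
    have hle (X : Fin 0 → E) : tiltedDeviation ν w X ≤ ‖w‖ := ciSup_le fun u => by
      simpa using (le_abs_self _).trans (abs_inner_le_of_mem_unitBall w u)
    have hmean := integral_mono_of_nonneg (μ := Measure.pi fun _ => ν)
      (.of_forall (tiltedDeviation_nonneg (hν.integrable one_le_two) w))
      (integrable_const ‖w‖) (.of_forall hle)
    simpa using hmean
  | n + 1, w => by
    have hint := hν.integrable one_le_two
    have hsq : Integrable (fun x => ‖x‖ ^ 2) ν := hν.integrable_norm_pow'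
    set τ := ∫ x, ‖x‖ ^ 2 ∂ν
    have : 0 ≤ τ := integral_nonneg fun _ => sq_nonneg _
    have hsum : Integrable (fun x => ‖w‖ ^ 2 + ‖(2 : ℝ) • x‖ ^ 2 + 4 * n * τ) ν := by
      simp_rw [norm_smul, mul_pow]
      exact ((integrable_const _).add (hsq.const_mul _)).add (integrable_const _)
    calc ∫ X : Fin (n + 1) → E, tiltedDeviation ν w X ∂Measure.pi (fun _ => ν)
        ≤ _ := integral_tiltedDeviation_succ_le hint w
      _ ≤ ∫ x, √(‖w‖ ^ 2 + ‖(2 : ℝ) • x‖ ^ 2 + 4 * n * τ) ∂ν := by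
          refine integral_mono_of_nonneg (.of_forall fun x => div_nonneg (add_nonneg
            (integral_nonneg (tiltedDeviation_nonneg hint _))
            (integral_nonneg (tiltedDeviation_nonneg hint _))) zero_le_two)
            (integrable_sqrt hsum) (.of_forall fun x => ?_)
          refine le_trans ?_ (add_sqrt_norm_sq_add_div_two_le w ((2 : ℝ) • x) (by positivity))
          rw [sub_eq_add_neg, ← neg_smul]
          exact div_le_div_of_nonneg_right (add_le_add (integral_tiltedDeviation_le hν n _)
            (integral_tiltedDeviation_le hν n _)) zero_le_two
      _ ≤ √(∫ x, (‖w‖ ^ 2 + ‖(2 : ℝ) • x‖ ^ 2 + 4 * n * τ) ∂ν) :=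
          integral_sqrt_le_sqrt_integral (fun x => by positivity) hsum
      _ = √(‖w‖ ^ 2 + 4 * (n + 1 : ℕ) * τ) := by
          simp_rw [norm_smul, mul_pow]
          rw [integral_add (by fun_prop) (integrable_const _),
            integral_add (integrable_const _) (hsq.const_mul _), integral_const_mul]
          simp only [integral_const, probReal_univ, smul_eq_mul, one_mul, Real.norm_ofNat,
            Nat.cast_add, Nat.cast_one, τ]
          ring_nf

end TiltedDeviation

section GaussianRounding

theorem integral_abs_gaussianReal (v : ℝ≥0) :
    ∫ x, |x| ∂gaussianReal 0 v = √(2 * v / Real.pi) := by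
  rcases eq_or_ne v 0 with rfl | hv
  · simp
  have : (0 : ℝ) < v := by positivity
  have hhalf : ∫ x in Set.Ioi (0 : ℝ), x * Real.exp (-x ^ 2 / (2 * v)) = v := by
    calc ∫ x in Set.Ioi (0 : ℝ), x * Real.exp (-x ^ 2 / (2 * v))
        = ∫ x in Set.Ioi (0 : ℝ), x ^ (1 : ℝ) * Real.exp (-(2 * v : ℝ)⁻¹ * x ^ (2 : ℝ)) := by
          simp only [Real.rpow_one, Real.rpow_ofNat, neg_mul, div_eq_inv_mul, mul_neg]
      _ = (2 * v : ℝ)⁻¹ ^ (-(1 + 1) / 2 : ℝ) * (1 / 2) * Real.Gamma ((1 + 1) / 2) :=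
          integral_rpow_mul_exp_neg_mul_rpow two_pos (by norm_num) (by positivity)
      _ = (2 * v : ℝ)⁻¹ ^ (-1 : ℝ) * (1 / 2) * Real.Gamma 1 := by norm_num
      _ = v := by
          rw [Real.rpow_neg_one, Real.Gamma_one]
          field_simp
  calc ∫ x, |x| ∂gaussianReal 0 v
      = (√(2 * Real.pi * v))⁻¹ * ∫ x : ℝ, |x| * Real.exp (-|x| ^ 2 / (2 * v)) := by
        simp only [integral_gaussianReal_eq_integral_smul hv, gaussianPDFReal, smul_eq_mul,
          sub_zero, sq_abs, mul_assoc, integral_const_mul, mul_comm |_|]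
    _ = (√(2 * Real.pi * v))⁻¹ * (2 * v) := by
        rw [integral_comp_abs (f := fun x => x * Real.exp (-x ^ 2 / (2 * v))), hhalf]
    _ = √(2 * v / Real.pi) := by
        rw [← div_eq_inv_mul, div_eq_iff (by positivity), ← Real.sqrt_mul (by positivity)]
        rw [show 2 * v / Real.pi * (2 * Real.pi * v) = (2 * v : ℝ) ^ 2 by field_simp,
          Real.sqrt_sq (by positivity)]

theorem integral_abs_dual_stdGaussian {F : Type*} [NormedAddCommGroup F] [InnerProductSpace ℝ F]
    [FiniteDimensional ℝ F] [MeasurableSpace F] [BorelSpace F] (L : StrongDual ℝ F) :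
    ∫ g, |L g| ∂stdGaussian F = √(2 / Real.pi) * ‖L‖ := by
  have hlaw : (stdGaussian F).map L = gaussianReal 0 (‖L‖₊ ^ 2) := by
    rw [IsGaussian.map_eq_gaussianReal, variance_dual_stdGaussian, integral_strongDual_stdGaussian]
    congr 1
    ext
    simp
  rw [← integral_map (f := fun x => |x|) (by fun_prop) (by fun_prop), hlaw,
    integral_abs_gaussianReal]
  simp only [NNReal.coe_pow, coe_nnnorm, mul_div_right_comm]
  rw [Real.sqrt_mul (by positivity), Real.sqrt_sq (norm_nonneg _)]

variable {ι E : Type*} [NormedAddCommGroup E] [InnerProductSpace ℝ E]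

/-- The image of `x` under the matrix with rows `c p`. The family `c` lives in the `ℓ²` sum of
copies of `E`, so that `‖c‖` is the Hilbert–Schmidt norm of this matrix. -/
noncomputable def innerRows (c : PiLp 2 fun _ : ι => E) (x : E) : EuclideanSpace ℝ ι :=
  WithLp.toLp 2 fun p => ⟪c p, x⟫

variable [Fintype ι]

theorem integral_mul_stdGaussian [DecidableEq ι] (p q : ι) :
    ∫ g : EuclideanSpace ℝ ι, g p * g q ∂stdGaussian _ = if p = q then 1 else 0 := by
  have h := covarianceBilin_apply (μ := stdGaussian (EuclideanSpace ℝ ι)) IsGaussian.memLp_two_id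
    (EuclideanSpace.single p 1) (EuclideanSpace.single q 1)
  rw [covarianceBilin_stdGaussian, innerSL_apply_apply] at h
  simpa [EuclideanSpace.inner_single_left, integral_id_stdGaussian, PiLp.single_apply]
    using h.symm

theorem integrable_mul_stdGaussian (p q : ι) :
    Integrable (fun g : EuclideanSpace ℝ ι => g p * g q) (stdGaussian _) :=
  have hcoord (p : ι) : MemLp (fun g : EuclideanSpace ℝ ι => g p) 2 (stdGaussian _) :=
    (EuclideanSpace.proj (𝕜 := ℝ) p).comp_memLp' IsGaussian.memLp_two_id
  (hcoord p).integrable_mul (hcoord q)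

theorem norm_sq_sum_smul (g : ι → ℝ) (c : ι → E) :
    ‖∑ p, g p • c p‖ ^ 2 = ∑ p, ∑ q, g p * g q * ⟪c p, c q⟫ := by
  simp only [← real_inner_self_eq_norm_sq, sum_inner, inner_sum, real_inner_smul_left,
    real_inner_smul_right]
  exact Finset.sum_congr rfl fun p _ => Finset.sum_congr rfl fun q _ => by
    rw [real_inner_comm]
    ring

theorem integral_norm_sq_sum_smul_stdGaussian (c : ι → E) :
    ∫ g : EuclideanSpace ℝ ι, ‖∑ p, g p • c p‖ ^ 2 ∂stdGaussian _ = ∑ p, ‖c p‖ ^ 2 := by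
  classical
  have hint (p q : ι) := (integrable_mul_stdGaussian p q).mul_const ⟪c p, c q⟫
  simp only [norm_sq_sum_smul]
  rw [integral_finsetSum _ fun p _ => integrable_finsetSum _ fun q _ => hint p q]
  refine Finset.sum_congr rfl fun p _ => ?_
  rw [integral_finsetSum _ fun q _ => hint p q]
  simp [integral_mul_const, integral_mul_stdGaussian]

theorem integrable_norm_sq_sum_smul_stdGaussian (c : ι → E) :
    Integrable (fun g : EuclideanSpace ℝ ι => ‖∑ p, g p • c p‖ ^ 2) (stdGaussian _) := by
  simp only [norm_sq_sum_smul]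
  exact integrable_finsetSum _ fun p _ => integrable_finsetSum _ fun q _ =>
    (integrable_mul_stdGaussian p q).mul_const _

theorem integrable_norm_sum_smul_stdGaussian (c : ι → E) :
    Integrable (fun g : EuclideanSpace ℝ ι => ‖∑ p, g p • c p‖) (stdGaussian _) := by
  simpa only [Real.sqrt_sq (norm_nonneg _)] using
    integrable_sqrt (integrable_norm_sq_sum_smul_stdGaussian c)

theorem integral_norm_sum_smul_stdGaussian_le (c : ι → E) :
    ∫ g : EuclideanSpace ℝ ι, ‖∑ p, g p • c p‖ ∂stdGaussian _ ≤ √(∑ p, ‖c p‖ ^ 2) := by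
  simpa only [Real.sqrt_sq (norm_nonneg _), integral_norm_sq_sum_smul_stdGaussian] using
    integral_sqrt_le_sqrt_integral (f := fun g : EuclideanSpace ℝ ι => ‖∑ p, g p • c p‖ ^ 2)
      (fun _ => sq_nonneg _) (integrable_norm_sq_sum_smul_stdGaussian c)

theorem inner_innerRows (c : PiLp 2 fun _ : ι => E) (x : E) (g : EuclideanSpace ℝ ι) :
    ⟪innerRows c x, g⟫ = ⟪x, ∑ p, g p • c p⟫ := by
  simp [innerRows, PiLp.inner_apply, inner_sum, real_inner_smul_right, real_inner_comm]

/-- Gaussian rounding: test the hypothesis on `u = ∑ g p • c p` with `g` standard Gaussian. -/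
theorem sum_norm_innerRows_le {κ : Type*} [Fintype κ] {X : κ → E} {S : ℝ} (hS : 0 ≤ S)
    (hX : ∀ u, ∑ i, |⟪X i, u⟫| ≤ S * ‖u‖) (c : PiLp 2 fun _ : ι => E) :
    ∑ i, ‖innerRows c (X i)‖ ≤ √(Real.pi / 2) * (S * ‖c‖) := by
  have habs (i : κ) : ∫ g, |⟪innerRows c (X i), g⟫| ∂stdGaussian _ =
      √(2 / Real.pi) * ‖innerRows c (X i)‖ := by
    simpa using integral_abs_dual_stdGaussian (innerSL ℝ (innerRows c (X i)))
  have hint (i : κ) : Integrable (fun g => ⟪innerRows c (X i), g⟫) (stdGaussian _) :=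
    (innerSL ℝ (innerRows c (X i))).integrable_comp IsGaussian.integrable_id
  have hmain : √(2 / Real.pi) * ∑ i, ‖innerRows c (X i)‖ ≤ S * ‖c‖ := by
    calc √(2 / Real.pi) * ∑ i, ‖innerRows c (X i)‖
        = ∫ g, ∑ i, |⟪innerRows c (X i), g⟫| ∂stdGaussian _ := by
          rw [integral_finsetSum _ fun i _ => (hint i).abs, Finset.mul_sum]
          simp only [habs]
      _ ≤ ∫ g : EuclideanSpace ℝ ι, S * ‖∑ p, g p • c p‖ ∂stdGaussian _ := by
          simp only [inner_innerRows]
          exact integral_mono_of_nonneg (.of_forall fun g => by positivity)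
            ((integrable_norm_sum_smul_stdGaussian _).const_mul S) (.of_forall fun g => hX _)
      _ ≤ S * ‖c‖ := by
          rw [integral_const_mul, PiLp.norm_eq_of_L2]
          exact mul_le_mul_of_nonneg_left (integral_norm_sum_smul_stdGaussian_le fun p => c p) hS
  rw [← inv_div, Real.sqrt_inv]
  rwa [← div_eq_inv_mul, le_div_iff₀' (by positivity)]

end GaussianRounding

section TruncatedMean

variable {ι E : Type*} [Fintype ι] [NormedAddCommGroup E] [InnerProductSpace ℝ E] {k : ℕ} {r : ℝ}

/-- The average of the lengths `‖innerRows c (X i)‖ / r`, truncated at `1`. -/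
noncomputable def truncatedMean (r : ℝ) (c : PiLp 2 fun _ : ι => E) (X : Fin k → E) : ℝ :=
  1 / k * ∑ i, min 1 (‖innerRows c (X i)‖ / r)

variable (ι) in
/-- The supremum of `truncatedMean` over the Hilbert–Schmidt unit ball, which bounds the value of
the centrality SDP when `X i = Z i - x`. -/
noncomputable def truncatedMeanSup (r : ℝ) (X : Fin k → E) : ℝ :=
  ⨆ c : Metric.closedBall (0 : PiLp 2 fun _ : ι => E) 1, truncatedMean r c.1 X

theorem truncatedMean_le_one (c : PiLp 2 fun _ : ι => E) (X : Fin k → E) :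
    truncatedMean r c X ≤ 1 :=
  calc truncatedMean r c X ≤ 1 / k * ∑ _i : Fin k, 1 := by
        unfold truncatedMean
        gcongr
        exact min_le_left _ _
    _ ≤ 1 := by simpa using inv_mul_le_one

theorem bddAbove_range_truncatedMean (X : Fin k → E) :
    BddAbove (Set.range fun c : Metric.closedBall (0 : PiLp 2 fun _ : ι => E) 1 =>
      truncatedMean r c.1 X) :=
  ⟨1, Set.forall_mem_range.2 fun c => truncatedMean_le_one c.1 X⟩

theorem truncatedMeanSup_nonneg (hr : 0 ≤ r) (X : Fin k → E) : 0 ≤ truncatedMeanSup ι r X :=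
  Real.iSup_nonneg fun _ => mul_nonneg (by positivity) <| Finset.sum_nonneg fun _ _ =>
    le_min zero_le_one (by positivity)

theorem continuous_truncatedMean (c : PiLp 2 fun _ : ι => E) :
    Continuous (truncatedMean r c : (Fin k → E) → ℝ) := by
  unfold truncatedMean innerRows
  fun_prop

theorem measurable_truncatedMeanSup [MeasurableSpace E] [BorelSpace E]
    [SecondCountableTopology E] : Measurable (truncatedMeanSup ι r : (Fin k → E) → ℝ) :=
  (lowerSemicontinuous_ciSup bddAbove_range_truncatedMean fun c =>
    (continuous_truncatedMean c.1).lowerSemicontinuous).measurable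

theorem hasBoundedDifferences_truncatedMean (hr : 0 ≤ r) (c : PiLp 2 fun _ : ι => E) :
    HasBoundedDifferences (fun X : Fin k → E => truncatedMean r c X) fun _ => 1 / k := by
  have hsum := hasBoundedDifferences_sum (n := k) (c := 1)
    (φ := fun x : E => min 1 (‖innerRows c x‖ / r)) fun x y =>
      (sub_le_self _ (le_min zero_le_one (by positivity))).trans (min_le_left _ _)
  simpa [truncatedMean] using hsum.const_mul (1 / k)

theorem hasBoundedDifferences_truncatedMeanSup (hr : 0 ≤ r) :
    HasBoundedDifferences (truncatedMeanSup ι r : (Fin k → E) → ℝ) fun _ => 1 / k :=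
  .iSup (fun c => hasBoundedDifferences_truncatedMean hr c.1) bddAbove_range_truncatedMean

theorem truncatedMeanSup_le (hr : 0 < r) {X : Fin k → E} {S : ℝ} (hS : 0 ≤ S)
    (hX : ∀ u, ∑ i, |⟪X i, u⟫| ≤ S * ‖u‖) :
    truncatedMeanSup ι r X ≤ √(Real.pi / 2) * S / (k * r) := by
  refine ciSup_le fun c => ?_
  calc truncatedMean r c.1 X ≤ 1 / k * ∑ i, ‖innerRows c.1 (X i)‖ / r := by
        unfold truncatedMean
        gcongr
        exact min_le_right _ _
    _ = (∑ i, ‖innerRows c.1 (X i)‖) / (k * r) := by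
        rw [← Finset.sum_div, one_div, div_mul_eq_div_div_swap, div_eq_inv_mul _ (k : ℝ)]
    _ ≤ √(Real.pi / 2) * S / (k * r) := by
        gcongr
        refine (sum_norm_innerRows_le hS hX _).trans ?_
        grw [mem_closedBall_zero_iff.1 c.2, mul_one]

variable [MeasurableSpace E] {ν : Measure E} {M : ℝ}

theorem sum_abs_inner_le_tiltedDeviation (hν : Integrable id ν)
    (hM : ∀ u, ∫ y, |⟪y, u⟫| ∂ν ≤ M * ‖u‖) (X : Fin k → E) (u : E) :
    ∑ i, |⟪X i, u⟫| ≤ (tiltedDeviation ν 0 X + k * M) * ‖u‖ := by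
  rcases eq_or_ne u 0 with rfl | hu
  · simp
  set e := ‖u‖⁻¹ • u
  have he : ‖e‖ = 1 := norm_smul_inv_norm hu
  have hue : u = ‖u‖ • e := (smul_inv_smul₀ (norm_ne_zero_iff.2 hu) u).symm
  have hdev := le_tiltedDeviation hν 0 X ⟨e, mem_closedBall_zero_iff.2 he.le⟩
  have hmean : k * ∫ y, |⟪y, e⟫| ∂ν ≤ k * M := by
    grw [hM e, he, mul_one]
  simp only [inner_zero_left, zero_add, Finset.sum_sub_distrib, Finset.sum_const,
    Finset.card_univ, Fintype.card_fin, nsmul_eq_mul] at hdev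
  calc ∑ i, |⟪X i, u⟫| = (∑ i, |⟪X i, e⟫|) * ‖u‖ := by
        rw [hue]
        simp only [real_inner_smul_right, abs_mul, abs_norm, Finset.mul_sum, norm_smul, he, mul_one,
          norm_norm, mul_comm]
    _ ≤ (tiltedDeviation ν 0 X + k * M) * ‖u‖ := by
        gcongr
        linarith

variable [BorelSpace E] [SecondCountableTopology E] [IsProbabilityMeasure ν]

theorem integral_truncatedMeanSup_le (hk : k ≠ 0) (hr : 0 < r) (hν : MemLp id 2 ν)
    (hM₀ : 0 ≤ M) (hM : ∀ u, ∫ y, |⟪y, u⟫| ∂ν ≤ M * ‖u‖) :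
    ∫ X : Fin k → E, truncatedMeanSup ι r X ∂Measure.pi (fun _ => ν) ≤
      √(Real.pi / 2) * (2 * √((∫ x, ‖x‖ ^ 2 ∂ν) / k) + M) / r := by
  have hν₁ := hν.integrable one_le_two
  have hsample (i : Fin k) : Integrable (fun X : Fin k → E => X i) (Measure.pi fun _ => ν) :=
    integrable_comp_eval (μ := fun _ => ν) (f := id) hν₁
  have hdev : Integrable (fun X : Fin k → E => tiltedDeviation ν 0 X) (Measure.pi fun _ => ν) :=
    integrable_tiltedDeviation hν₁ continuous_const continuous_apply (integrable_const 0) hsample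
  have hnonneg := tiltedDeviation_nonneg (n := k) hν₁ 0
  have hsqrt : √(‖(0 : E)‖ ^ 2 + 4 * k * ∫ x, ‖x‖ ^ 2 ∂ν) = 2 * k * √((∫ x, ‖x‖ ^ 2 ∂ν) / k) := by
    rw [show ‖(0 : E)‖ ^ 2 + 4 * k * ∫ x, ‖x‖ ^ 2 ∂ν =
        (2 * k) ^ 2 * ((∫ x, ‖x‖ ^ 2 ∂ν) / k) by rw [norm_zero]; field_simp; ring,
      Real.sqrt_mul (by positivity), Real.sqrt_sq (by positivity)]
  calc ∫ X : Fin k → E, truncatedMeanSup ι r X ∂Measure.pi (fun _ => ν)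
      ≤ ∫ X : Fin k → E, √(Real.pi / 2) * (tiltedDeviation ν 0 X + k * M) / (k * r)
          ∂Measure.pi (fun _ => ν) :=
        integral_mono_of_nonneg (.of_forall (truncatedMeanSup_nonneg hr.le))
          (((hdev.add (integrable_const _)).const_mul _).div_const _)
          (.of_forall fun X => truncatedMeanSup_le hr (add_nonneg (hnonneg X) (by positivity))
            (sum_abs_inner_le_tiltedDeviation hν₁ hM X))
    _ = √(Real.pi / 2) * ((∫ X : Fin k → E, tiltedDeviation ν 0 X ∂Measure.pi (fun _ => ν)) +
          k * M) / (k * r) := by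
        rw [integral_div, integral_const_mul, integral_add hdev (integrable_const _),
          integral_const, probReal_univ, one_smul]
    _ ≤ √(Real.pi / 2) * (2 * k * √((∫ x, ‖x‖ ^ 2 ∂ν) / k) + k * M) / (k * r) := by
        grw [integral_tiltedDeviation_le hν k 0, hsqrt]
    _ = √(Real.pi / 2) * (2 * √((∫ x, ‖x‖ ^ 2 ∂ν) / k) + M) / r := by
        field_simp

theorem measureReal_add_le_truncatedMeanSup_le (hr : 0 ≤ r) {p ε : ℝ} (hε : 0 ≤ ε)
    (hp : ∫ X : Fin k → E, truncatedMeanSup ι r X ∂Measure.pi (fun _ => ν) ≤ p) :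
    (Measure.pi fun _ => ν).real {X : Fin k → E | p + ε ≤ truncatedMeanSup ι r X} ≤
      Real.exp (-2 * ε ^ 2 * k) := by
  have htail := (hasBoundedDifferences_truncatedMeanSup hr).measureReal_integral_add_le
    (ν := fun _ : Fin k => ν) (measurable_truncatedMeanSup (ι := ι)) hε
  refine (measureReal_mono fun X hX => ?_).trans (htail.trans_eq ?_)
  · exact (add_le_add_left hp ε).trans hX
  · congr 1
    rcases eq_or_ne k 0 with rfl | hk
    · simp
    · simp only [Finset.sum_const, Finset.card_univ, Fintype.card_fin, nsmul_eq_mul, NNReal.coe_div,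
        NNReal.coe_one, NNReal.coe_natCast]
      field_simp

end TruncatedMean

section GramRelaxation

open scoped ComplexOrder MatrixOrder Matrix.Norms.L2Operator in
theorem exists_gram_eq {𝕜 ι : Type*} [RCLike 𝕜] [Fintype ι] {A : Matrix ι ι 𝕜}
    (hA : A.PosSemidef) : ∃ v : ι → EuclideanSpace 𝕜 ι, Matrix.gram 𝕜 v = A := by
  classical
  obtain ⟨L, rfl⟩ := CStarAlgebra.nonneg_iff_eq_star_mul_self.mp hA.nonneg
  refine ⟨fun a => WithLp.toLp 2 fun p => L p a, Matrix.ext fun a b => ?_⟩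
  simp [Matrix.gram_apply, PiLp.inner_apply, Matrix.mul_apply, mul_comm]

variable {ι κ : Type*}

/-- The rows of the matrix with columns `v j`. -/
noncomputable def rowsOfColumns (v : κ → EuclideanSpace ℝ ι) :
    PiLp 2 fun _ : ι => EuclideanSpace ℝ κ :=
  WithLp.toLp 2 fun p => WithLp.toLp 2 fun j => v j p

variable [Fintype κ]

theorem innerRows_rowsOfColumns (v : κ → EuclideanSpace ℝ ι) (z : EuclideanSpace ℝ κ) :
    innerRows (rowsOfColumns v) z = ∑ j, z j • v j := by
  ext p
  simp [innerRows, rowsOfColumns, PiLp.inner_apply]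

variable [Fintype ι]

theorem norm_sq_rowsOfColumns (v : κ → EuclideanSpace ℝ ι) :
    ‖rowsOfColumns v‖ ^ 2 = ∑ j, ‖v j‖ ^ 2 := by
  simp only [PiLp.norm_sq_eq_of_L2, rowsOfColumns]
  exact Finset.sum_comm

namespace CentralitySDP

variable {k d : ℕ} {Z : Fin k → EuclideanSpace ℝ (Fin d)} {x : EuclideanSpace ℝ (Fin d)} {r : ℝ}
  {v : SDPIndex k d → EuclideanSpace ℝ ι}

theorem inner_rowW_gram (v : SDPIndex k d → EuclideanSpace ℝ ι) (i : Fin k)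
    (z : EuclideanSpace ℝ (Fin d)) :
    ⟪z, rowW (Matrix.gram ℝ v) i⟫ =
      ⟪v (.inr (.inl i)), innerRows (rowsOfColumns fun j => v (.inr (.inr j))) z⟫ := by
  rw [innerRows_rowsOfColumns, inner_sum, PiLp.inner_apply]
  simp only [rowW, Matrix.gram_apply, real_inner_smul_right, RCLike.inner_apply, conj_trivial,
    mul_comm]

theorem Feasible.norm_le_one (hv : Feasible Z x r (Matrix.gram ℝ v)) (i : Fin k) :
    ‖v (.inr (.inl i))‖ ≤ 1 := by
  rw [← sq_le_one_iff₀ (norm_nonneg _), ← real_inner_self_eq_norm_sq]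
  exact hv.diag_le i

theorem Feasible.norm_rowsOfColumns_le_one (hv : Feasible Z x r (Matrix.gram ℝ v)) :
    ‖rowsOfColumns fun j => v (.inr (.inr j))‖ ≤ 1 := by
  rw [← sq_le_one_iff₀ (norm_nonneg _), norm_sq_rowsOfColumns]
  simpa [Matrix.trace, blockU, Matrix.gram_apply] using hv.trace_le

theorem Feasible.blockb_le_one (hv : Feasible Z x r (Matrix.gram ℝ v)) (i : Fin k) :
    blockb (Matrix.gram ℝ v) i ≤ 1 := by
  have hcorner : ‖v (.inl ())‖ ≤ 1 := by
    rw [← sq_le_one_iff₀ (norm_nonneg _), ← real_inner_self_eq_norm_sq]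
    exact hv.corner.le
  exact (real_inner_le_norm _ _).trans (mul_le_one₀ (hv.norm_le_one i) (norm_nonneg _) hcorner)

theorem Feasible.mul_blockb_le (hv : Feasible Z x r (Matrix.gram ℝ v)) (i : Fin k) :
    r * blockb (Matrix.gram ℝ v) i ≤
      ‖innerRows (rowsOfColumns fun j => v (.inr (.inr j))) (Z i - x)‖ :=
  calc r * blockb (Matrix.gram ℝ v) i ≤ ⟪Z i - x, rowW (Matrix.gram ℝ v) i⟫ := hv.inner_ge i
    _ ≤ ‖innerRows (rowsOfColumns fun j => v (.inr (.inr j))) (Z i - x)‖ := by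
      rw [inner_rowW_gram]
      grw [real_inner_le_norm, hv.norm_le_one i, one_mul]

theorem value_le_truncatedMeanSup (hr : 0 < r) :
    value Z x r ≤ truncatedMeanSup (SDPIndex k d) r fun i => Z i - x := by
  refine csSup_le (objective_nonempty Z x r) (Set.forall_mem_image.2 fun Y hY => ?_)
  obtain ⟨v, rfl⟩ := exists_gram_eq hY.posSemidef
  refine le_trans ?_ (le_ciSup (bddAbove_range_truncatedMean _)
    ⟨_, mem_closedBall_zero_iff.2 hY.norm_rowsOfColumns_le_one⟩)
  unfold objective truncatedMean
  gcongr with i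
  exact le_min (hY.blockb_le_one i) ((le_div_iff₀' hr).2 (hY.mul_blockb_le i))

end CentralitySDP

end GramRelaxation

section Covariance

variable {d : ℕ} {Ω : Type*} [MeasurableSpace Ω] {P : Measure Ω} [IsProbabilityMeasure P]
  {Z : Ω → EuclideanSpace ℝ (Fin d)}

theorem covMatrix_apply (hZ : MemLp Z 2 P) (a b : Fin d) :
    covMatrix Z P a b = ∫ ω, (Z ω - ∫ ω', Z ω' ∂P) a * (Z ω - ∫ ω', Z ω' ∂P) b ∂P := by
  have hmean (a : Fin d) : (∫ ω, Z ω ∂P) a = ∫ ω, Z ω a ∂P :=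
    ((EuclideanSpace.proj (𝕜 := ℝ) a).integral_comp_comm (hZ.integrable one_le_two)).symm
  simp only [covMatrix, Matrix.of_apply, covariance, PiLp.sub_apply, hmean]

theorem integrable_sub_mean_mul (hZ : MemLp Z 2 P) (a b : Fin d) :
    Integrable (fun ω => (Z ω - ∫ ω', Z ω' ∂P) a * (Z ω - ∫ ω', Z ω' ∂P) b) P :=
  have hcoord (a : Fin d) : MemLp (fun ω => (Z ω - ∫ ω', Z ω' ∂P) a) 2 P :=
    (EuclideanSpace.proj (𝕜 := ℝ) a).comp_memLp' (hZ.sub (memLp_const _))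
  (hcoord a).integrable_mul (hcoord b)

theorem integral_norm_sub_mean_sq (hZ : MemLp Z 2 P) :
    ∫ ω, ‖Z ω - ∫ ω', Z ω' ∂P‖ ^ 2 ∂P = (covMatrix Z P).trace := by
  simp only [Matrix.trace, Matrix.diag_apply, covMatrix_apply hZ]
  rw [← integral_finsetSum _ fun a _ => integrable_sub_mean_mul hZ a a]
  simp only [EuclideanSpace.real_norm_sq_eq, ← sq]

theorem integral_inner_sub_mean_sq (hZ : MemLp Z 2 P) (u : EuclideanSpace ℝ (Fin d)) :
    ∫ ω, ⟪Z ω - ∫ ω', Z ω' ∂P, u⟫ ^ 2 ∂P =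
      ⟪u, Matrix.toEuclideanCLM (n := Fin d) (𝕜 := ℝ) (covMatrix Z P) u⟫ := by
  have hexpand (y : EuclideanSpace ℝ (Fin d)) :
      ⟪y, u⟫ ^ 2 = ∑ a, ∑ b, u a * u b * (y a * y b) := by
    simp only [PiLp.inner_apply, sq, Finset.sum_mul_sum, RCLike.inner_apply, conj_trivial,
      mul_mul_mul_comm]
  have hint (a b : Fin d) := (integrable_sub_mean_mul hZ a b).const_mul (u a * u b)
  simp only [hexpand]
  rw [integral_finsetSum _ fun a _ => integrable_finsetSum _ fun b _ => hint a b,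
    PiLp.inner_apply]
  refine Finset.sum_congr rfl fun a _ => ?_
  rw [integral_finsetSum _ fun b _ => hint a b]
  simp only [integral_const_mul, ← covMatrix_apply hZ, RCLike.inner_apply, conj_trivial,
    Matrix.ofLp_toEuclideanCLM, Matrix.mulVec, dotProduct, Finset.sum_mul]
  exact Finset.sum_congr rfl fun b _ => by ring

theorem integral_inner_sub_mean_sq_le (hZ : MemLp Z 2 P) (u : EuclideanSpace ℝ (Fin d)) :
    ∫ ω, ⟪Z ω - ∫ ω', Z ω' ∂P, u⟫ ^ 2 ∂P ≤ matrixOpNorm (covMatrix Z P) * ‖u‖ ^ 2 := by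
  rw [integral_inner_sub_mean_sq hZ, matrixOpNorm]
  grw [real_inner_le_norm, ContinuousLinearMap.le_opNorm]
  exact le_of_eq (by ring)

theorem integral_abs_inner_sub_mean_le (hZ : MemLp Z 2 P) (u : EuclideanSpace ℝ (Fin d)) :
    ∫ ω, |⟪Z ω - ∫ ω', Z ω' ∂P, u⟫| ∂P ≤ √(matrixOpNorm (covMatrix Z P)) * ‖u‖ := by
  have hinner : MemLp (fun ω => ⟪Z ω - ∫ ω', Z ω' ∂P, u⟫) 2 P :=
    (hZ.sub (memLp_const _)).inner_const u
  calc ∫ ω, |⟪Z ω - ∫ ω', Z ω' ∂P, u⟫| ∂P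
      ≤ √(∫ ω, ⟪Z ω - ∫ ω', Z ω' ∂P, u⟫ ^ 2 ∂P) := by
        simpa only [Real.sqrt_sq_eq_abs] using
          integral_sqrt_le_sqrt_integral (fun _ => sq_nonneg _) hinner.integrable_sq
    _ ≤ √(matrixOpNorm (covMatrix Z P)) * ‖u‖ := by
        grw [integral_inner_sub_mean_sq_le hZ]
        rw [Real.sqrt_mul' _ (sq_nonneg _), Real.sqrt_sq (norm_nonneg _)]

end Covariance

section Centrality

variable {k d : ℕ} {r : ℝ} {Ω₀ Ω : Type*} [MeasurableSpace Ω₀] [MeasurableSpace Ω]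
  {P₀ : Measure Ω₀} {P : Measure Ω} [IsProbabilityMeasure P]

theorem map_eq_pi_of_iIndepFun_of_identDistrib {ι E : Type*} [Fintype ι] [MeasurableSpace E]
    {X : ι → Ω → E} {Y : Ω₀ → E} (hindep : iIndepFun X P)
    (hident : ∀ i, IdentDistrib (X i) Y P P₀) :
    P.map (fun ω i => X i ω) = Measure.pi fun _ => P₀.map Y := by
  rw [(iIndepFun_iff_map_fun_eq_pi_map fun i => (hident i).aemeasurable_fst).1 hindep]
  exact congrArg Measure.pi (funext fun i => (hident i).map_eq)

theorem integral_truncatedMeanSup_map_sub_mean_le {ι : Type*} [Fintype ι]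
    [IsProbabilityMeasure P₀] {Z : Ω₀ → EuclideanSpace ℝ (Fin d)} (hk : k ≠ 0) (hr : 0 < r)
    (hZ : MemLp Z 2 P₀) :
    ∫ X : Fin k → EuclideanSpace ℝ (Fin d), truncatedMeanSup ι r X
        ∂Measure.pi (fun _ => P₀.map fun ω => Z ω - ∫ ω', Z ω' ∂P₀) ≤
      √(Real.pi / 2) * (2 * √((covMatrix Z P₀).trace / k) +
        √(matrixOpNorm (covMatrix Z P₀))) / r := by
  have hX : MemLp (fun ω => Z ω - ∫ ω', Z ω' ∂P₀) 2 P₀ := hZ.sub (memLp_const _)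
  have hXm := hX.aestronglyMeasurable.aemeasurable
  have := Measure.isProbabilityMeasure_map hXm
  rw [← integral_norm_sub_mean_sq hZ, ← integral_map (f := fun x => ‖x‖ ^ 2) hXm (by fun_prop)]
  refine integral_truncatedMeanSup_le hk hr
    ((memLp_map_measure_iff aestronglyMeasurable_id hXm).2 hX) (Real.sqrt_nonneg _) fun u => ?_
  rw [integral_map hXm (by fun_prop)]
  exact integral_abs_inner_sub_mean_le hZ u

theorem measureReal_not_certifiablyCentral_le {Z : Fin k → Ω → EuclideanSpace ℝ (Fin d)}
    {x : EuclideanSpace ℝ (Fin d)} {ν : Measure (EuclideanSpace ℝ (Fin d))}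
    [IsProbabilityMeasure ν] {p ε : ℝ} (hr : 0 < r) (hε : 0 ≤ ε)
    (hlaw : P.map (fun ω i => Z i ω - x) = Measure.pi fun _ => ν)
    (hp : ∫ X : Fin k → EuclideanSpace ℝ (Fin d), truncatedMeanSup (SDPIndex k d) r X
      ∂Measure.pi (fun _ => ν) ≤ p) :
    P.real {ω | ¬ CertifiablyCentral (fun i => Z i ω) r (p + ε) x} ≤
      Real.exp (-2 * ε ^ 2 * k) := by
  have hmeas : AEMeasurable (fun ω i => Z i ω - x) P :=
    AEMeasurable.of_map_ne_zero (hlaw ▸ IsProbabilityMeasure.ne_zero _)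
  calc P.real {ω | ¬ CertifiablyCentral (fun i => Z i ω) r (p + ε) x}
      ≤ P.real ((fun ω i => Z i ω - x) ⁻¹'
          {X | p + ε ≤ truncatedMeanSup (SDPIndex k d) r X}) :=
        measureReal_mono fun ω hω =>
          (not_le.1 hω).le.trans (CentralitySDP.value_le_truncatedMeanSup hr)
    _ = (Measure.pi fun _ => ν).real {X | p + ε ≤ truncatedMeanSup (SDPIndex k d) r X} := by
        rw [← hlaw, map_measureReal_apply_of_aemeasurable hmeas
          (measurableSet_le measurable_const measurable_truncatedMeanSup)]
    _ ≤ Real.exp (-2 * ε ^ 2 * k) := measureReal_add_le_truncatedMeanSup_le hr.le hε hp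

end Centrality

theorem mainTheorem2 :
    ∃ C > (0 : ℝ), ∃ c > (0 : ℝ), ∀ (d k : ℕ), 1 ≤ k →
      ∀ (Ω₀ : Type*) [MeasurableSpace Ω₀] (P₀ : Measure Ω₀) [IsProbabilityMeasure P₀]
        (Z : Ω₀ → EuclideanSpace ℝ (Fin d)), MemLp Z 2 P₀ →
      ∀ (Ω : Type*) [MeasurableSpace Ω] (P : Measure Ω) [IsProbabilityMeasure P]
        (Zs : Fin k → Ω → EuclideanSpace ℝ (Fin d)),
        iIndepFun Zs P → (∀ i, IdentDistrib (Zs i) Z P P₀) →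
      ∀ r : ℝ, 0 < r →
        C * (Real.sqrt ((covMatrix Z P₀).trace / k) + Real.sqrt (matrixOpNorm (covMatrix Z P₀)))
          ≤ r →
        P {ω | ¬ CertifiablyCentral (fun i => Zs i ω) r (1 / 100) (∫ ω₀, Z ω₀ ∂P₀)}
          ≤ ENNReal.ofReal ((2 : ℝ) ^ (-(c * (k : ℝ)))) := by
  -- Mean and deviation of the truncated supremum each get half of `1 / 100`, and the tail is then
  -- `exp (-2 * k / 200 ^ 2) = exp (-k / 20000)`.
  refine ⟨400 * √(Real.pi / 2), by positivity, 1 / 20000, by norm_num, ?_⟩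
  intro d k hk Ω₀ _ P₀ _ Z hZ Ω _ P _ Zs hindep hident r hr hrC
  set μ := ∫ ω₀, Z ω₀ ∂P₀
  set τ := √((covMatrix Z P₀).trace / k)
  set σ := √(matrixOpNorm (covMatrix Z P₀))
  have : IsProbabilityMeasure (P₀.map fun ω => Z ω - μ) :=
    Measure.isProbabilityMeasure_map (hZ.aestronglyMeasurable.aemeasurable.sub_const μ)
  have hlaw : P.map (fun ω i => Zs i ω - μ) = Measure.pi fun _ => P₀.map fun ω => Z ω - μ :=
    map_eq_pi_of_iIndepFun_of_identDistrib
      (hindep.comp (fun _ x => x - μ) fun _ => measurable_sub_const μ)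
      fun i => (hident i).comp (measurable_sub_const μ)
  have hmean : √(Real.pi / 2) * (2 * τ + σ) / r ≤ 1 / 200 := by
    rw [div_le_iff₀ hr]
    nlinarith [mul_nonneg (Real.sqrt_nonneg (Real.pi / 2)) (Real.sqrt_nonneg _ : 0 ≤ σ)]
  have htail := measureReal_not_certifiablyCentral_le (ε := 1 / 200) hr (by norm_num) hlaw
    ((integral_truncatedMeanSup_map_sub_mean_le (by lia) hr hZ).trans hmean)
  have hexp : Real.exp (-2 * (1 / 200) ^ 2 * k) ≤ 2 ^ (-(1 / 20000 * (k : ℝ))) := by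
    rw [Real.rpow_def_of_pos two_pos, Real.exp_le_exp]
    nlinarith [Real.log_two_lt_d9, k.cast_nonneg (α := ℝ)]
  rw [show (1 / 100 : ℝ) = 1 / 200 + 1 / 200 by norm_num, ← ofReal_measureReal]
  exact ENNReal.ofReal_le_ofReal (htail.trans hexp)
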